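/- Let $F = F(x,y)$ be the free group of rank two with basis $\{x, y\}$. Call $w \in F$ \emph{primitive} if it is the image of $x$ under some automorphism of $F$. Let $\alpha_x$ and $\alpha_y$ be the automorphisms of $F$ with $\alpha_x(x) = x^{-1}$, $\alpha_x(y) = y$ and $\alpha_y(x) = x$, $\alpha_y(y) = y^{-1}$, and let $\Psi : F \to F$, $\Psi(w) = \alpha_y(\alpha_x(w^{-1}))$, be the map that reverses words. Call $w \in F$ a \emph{palindrome} if $\Psi(w) = w$, that is, if its reduced word in $x^{\pm 1}, y^{\pm 1}$ reads the same forwards and backwards. Then every primitive element $p \in F$ is a palindrome or a product $p = uv$ of two palindromes $u, v \in F$. -/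

import Mathlib

/-- The free group `F = F(x, y)` of rank two. -/
abbrev F2 : Type := FreeGroup (Fin 2)

namespace F2

/-- The first free generator. -/
def x : F2 := FreeGroup.of 0

/-- The second free generator. -/
def y : F2 := FreeGroup.of 1

/-- The automorphism `x ↦ x⁻¹`, `y ↦ y`. -/
def alphaX : MulAut F2 :=
  MonoidHom.toMulEquiv (FreeGroup.lift ![x⁻¹, y]) (FreeGroup.lift ![x⁻¹, y])
    (by ext i; fin_cases i <;> simp [x, y])
    (by ext i; fin_cases i <;> simp [x, y])

/-- The automorphism `x ↦ x`, `y ↦ y⁻¹`. -/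
def alphaY : MulAut F2 :=
  MonoidHom.toMulEquiv (FreeGroup.lift ![x, y⁻¹]) (FreeGroup.lift ![x, y⁻¹])
    (by ext i; fin_cases i <;> simp [x, y])
    (by ext i; fin_cases i <;> simp [x, y])

/-- The reversal map `Ψ : F → F`: invert `w`, then apply `alphaX`, then `alphaY`. -/
def Psi (w : F2) : F2 := alphaY (alphaX w⁻¹)

/-- `w` reads the same forwards and backwards. -/
def IsPalindrome (w : F2) : Prop := Psi w = w

/-- `w` is the image of the generator `x` under some automorphism of `F`. -/
def IsPrimitive (w : F2) : Prop := ∃ θ : MulAut F2, θ x = w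

end F2

/-!
Let `Ψ` be word reversal. The proof shows that any two generators `a, b` of `F2` have a common
reversal: a palindrome `g` with `Ψ a = g⁻¹ * a * g` and `Ψ b = g⁻¹ * b * g`
(`F2.Generates.commonReversal`). If `θ x = p`, this applies to `a = p` and `b = θ y`, and then
`p = (p * g) * g⁻¹` is a product of two palindromes, because `Ψ (p * g) = g * (g⁻¹ * p * g)`.

Having a common reversal is unaffected by swapping and inverting the generators, by passing from
`(a, b)` to `(a * b, b)`, and by conjugating both generators. Hence a counterexample of least total
length `|a| + |b|` cannot be shortened by any of these moves. Such a pair is Nielsen reduced: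

* in a product of two letters from `a, a⁻¹, b, b⁻¹`, not inverse to each other, at most half of either
  factor cancels;
* in a product `u * v * w` of three such letters, `v` does not cancel completely. If it did, half of
  it would cancel on each side. For `w = u` the pair `(u * v, v)` would be conjugate to a shorter one
  (`FreeGroup.exists_conj_norm_lt`), and for `w = u⁻¹` the halves of `v` would be inverse to each other
  (`FreeGroup.eq_one_of_norm_mul_eq`).

The four-point condition in the Cayley tree (`FreeGroup.norm_mul_mul_add_norm`) extends this to
reduced words of any length in `a` and `b`, and it follows that such a word represents an element of
length one only if it is a single letter. As `x` and `y` are words in `a` and `b`, the pair is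
`(x, y)` up to order and inversion, for which `g = 1` is a common reversal.
-/

namespace FreeGroup

variable {α : Type*} [DecidableEq α]

/-! ### Cancellation in free groups -/

theorem toWord_mul_of_norm_mul {u v : FreeGroup α} (h : (u * v).norm = u.norm + v.norm) :
    (u * v).toWord = u.toWord ++ v.toWord :=
  (toWord_mul_sublist u v).eq_of_length (by simpa [norm] using h)

theorem norm_mk_of_isReduced {L : List (α × Bool)} (h : IsReduced L) :
    (mk L).norm = L.length := by
  rw [norm, toWord_mk, h.reduce_eq]

/-- If `u * v` is shorter than `|u| + |v|`, then the last letter of `u` cancels against the first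
letter of `v`. -/
theorem exists_letter_of_norm_mul_lt {u v : FreeGroup α} (h : (u * v).norm < u.norm + v.norm) :
    ∃ l r s : FreeGroup α, u = r * l⁻¹ ∧ v = l * s ∧ l.norm ≤ 1 ∧
      u.norm = r.norm + 1 ∧ v.norm = s.norm + 1 := by
  have hred : ¬ IsReduced (u.toWord ++ v.toWord) := by
    intro hr
    have := norm_mk_of_isReduced hr
    rw [← mul_mk, mk_toWord, mk_toWord, List.length_append] at this
    exact h.ne this
  rw [IsReduced, List.isChain_append] at hred
  have hu : IsReduced u.toWord := isReduced_toWord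
  have hv : IsReduced v.toWord := isReduced_toWord
  have hx : ∃ a ∈ u.toWord.getLast?, ∃ b ∈ v.toWord.head?, a.1 = b.1 ∧ a.2 ≠ b.2 := by
    by_contra! hc
    exact hred ⟨hu, hv, hc⟩
  obtain ⟨a, ha, b, hb, hab, hab'⟩ := hx
  obtain ⟨L, hL⟩ := List.getLast?_eq_some_iff.1 ha
  obtain ⟨M, hM⟩ := List.head?_eq_some_iff.1 hb
  have hu' : u = mk L * mk [a] := by rw [mul_mk, ← hL, mk_toWord]
  have hv' : v = mk [b] * mk M := by rw [mul_mk, List.singleton_append, ← hM, mk_toWord]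
  have hinv : (mk [b])⁻¹ = mk [a] := by
    obtain ⟨a, c⟩ := a
    obtain ⟨b, d⟩ := b
    simp only at hab hab'
    subst hab
    have : c = !d := by cases c <;> cases d <;> simp_all
    simp [inv_mk, invRev, this]
  refine ⟨mk [b], mk L, mk M, by rw [hinv, hu'], hv', norm_mk_le, ?_, ?_⟩
  · rw [norm, hL, norm_mk_of_isReduced (hu.infix ⟨[], [a], by simp [hL]⟩)]
    simp
  · rw [norm, hM, norm_mk_of_isReduced (hv.infix ⟨[b], [], by simp [hM]⟩)]
    simp

/-- Every product factors as `u * v = (r * d⁻¹) * (d * s) = r * s`, where `d` is the part that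
cancels and no other cancellation occurs. -/
theorem exists_cancellation (u v : FreeGroup α) :
    ∃ r d s : FreeGroup α, u = r * d⁻¹ ∧ v = d * s ∧ u.norm = r.norm + d.norm ∧
      v.norm = d.norm + s.norm ∧ (u * v).norm = r.norm + s.norm := by
  induction hn : u.norm using Nat.strong_induction_on generalizing u v with
  | _ n ih =>
    subst hn
    rcases (norm_mul_le u v).lt_or_eq with h | h
    · obtain ⟨l, u', v', rfl, rfl, hl, hu, hv⟩ := exists_letter_of_norm_mul_lt h
      obtain ⟨r, d, s, rfl, rfl, h1, h2, h3⟩ := ih _ (by omega) u' v' rfl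
      refine ⟨r, l * d, s, by group, by group, ?_⟩
      have e1 := norm_mul_le r (l * d)⁻¹
      have e2 := norm_mul_le l d
      rw [norm_inv_eq] at e1
      have e3 : r * d⁻¹ * l⁻¹ = r * (l * d)⁻¹ := by group
      rw [← e3] at e1
      have e4 : r * d⁻¹ * l⁻¹ * (l * (d * s)) = r * d⁻¹ * (d * s) := by group
      rw [e4]
      omega
    · exact ⟨u, 1, v, by simp, by simp, by simp, by simp, h⟩

/-- Of two initial segments of the same reduced word, the shorter one is an initial segment of the
longer one. -/
theorem exists_eq_mul_of_mul_eq_mul {d s d' s' : FreeGroup α} (h : d * s = d' * s')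
    (hd : (d * s).norm = d.norm + s.norm) (hd' : (d' * s').norm = d'.norm + s'.norm)
    (hle : d.norm ≤ d'.norm) :
    ∃ e, d' = d * e ∧ s = e * s' ∧ d'.norm = d.norm + e.norm := by
  have h1 := toWord_mul_of_norm_mul hd
  have h2 := toWord_mul_of_norm_mul hd'
  obtain ⟨E, hE⟩ : d.toWord <+: d'.toWord :=
    List.prefix_of_prefix_length_le (l₃ := (d * s).toWord) ⟨_, h1.symm⟩ ⟨_, by rw [h, h2]⟩ hle
  have he : d' = d * mk E := by
    rw [← mk_toWord (x := d'), ← hE, ← mul_mk, mk_toWord]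
  refine ⟨mk E, he, ?_, ?_⟩
  · rw [he, mul_assoc] at h
    exact mul_left_cancel h
  · have hr : IsReduced E :=
      (isReduced_toWord (x := d')).infix ⟨d.toWord, [], by simp [hE]⟩
    rw [norm_mk_of_isReduced hr, norm, norm, ← hE, List.length_append]

theorem eq_of_mul_eq_mul_of_norm_eq {d s d' s' : FreeGroup α} (h : d * s = d' * s')
    (hd : (d * s).norm = d.norm + s.norm) (hd' : (d' * s').norm = d'.norm + s'.norm)
    (he : d.norm = d'.norm) : d = d' ∧ s = s' := by
  obtain ⟨e, h1, h2, h3⟩ := exists_eq_mul_of_mul_eq_mul h hd hd' he.le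
  obtain rfl : e = 1 := norm_eq_zero.1 (by omega)
  simp_all

theorem norm_mul_mul_of_ne_one {r m t : FreeGroup α} (hm : m ≠ 1)
    (h1 : (r * m).norm = r.norm + m.norm) (h2 : (m * t).norm = m.norm + t.norm) :
    (r * m * t).norm = r.norm + m.norm + t.norm := by
  have e1 := toWord_mul_of_norm_mul h1
  have e2 := toWord_mul_of_norm_mul h2
  have hr : IsReduced (r.toWord ++ m.toWord ++ t.toWord) :=
    IsReduced.append_overlap (e1 ▸ isReduced_toWord) (e2 ▸ isReduced_toWord)
      (by rwa [Ne, toWord_eq_nil_iff])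
  have := norm_mk_of_isReduced hr
  simpa [← mul_mk, mk_toWord, norm, mul_assoc, add_assoc] using this

/-- The four-point condition for the word metric: in the Cayley tree with the points
`1, g, g * v, g * v * w`, if the segments `[1, g]` and `[g * v, g * v * w]` are far enough apart,
then the other two sums of opposite distances agree. -/
theorem norm_mul_mul_add_norm {g v w : FreeGroup α}
    (h : g.norm + w.norm < (g * v).norm + (v * w).norm) :
    (g * v * w).norm + v.norm = (g * v).norm + (v * w).norm := by
  obtain ⟨r, d, s, hg, hv, h1, h2, h3⟩ := exists_cancellation g v
  obtain ⟨p, e, t, hv', hw, h4, h5, h6⟩ := exists_cancellation v w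
  obtain ⟨m, rfl, rfl, h7⟩ := exists_eq_mul_of_mul_eq_mul (hv.symm.trans hv')
    (by rw [← hv, h2]) (by rw [← hv', norm_inv_eq, h4]) (by omega)
  -- Here `v = d * m * e⁻¹`, where only `d` and `e⁻¹` cancel, and `m` survives in `g * v * w`.
  have hm : m ≠ 1 := by
    rintro rfl
    simp only [norm_one] at h7
    omega
  have e1 : g * v = r * m * e⁻¹ := by rw [hg, hv]; group
  have e2 : v * w = d * (m * t) := by rw [hv', hw]; group
  have e3 : g * v * w = r * m * t := by rw [e1, hw]; group
  have e4 := norm_mul_le (r * m) e⁻¹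
  have e5 := norm_mul_le d (m * t)
  have e6 := norm_mul_le r m
  have e7 := norm_mul_le m t
  have e8 := norm_mul_le m e⁻¹
  rw [norm_inv_eq] at e4 e8
  rw [← e1] at e4
  rw [← e2] at e5
  have := norm_mul_mul_of_ne_one (r := r) (t := t) hm (by omega) (by omega)
  rw [e3]
  omega

theorem norm_lt_norm_mul_self {u : FreeGroup α} (hu : u ≠ 1) : u.norm < (u * u).norm := by
  by_contra! hle
  obtain ⟨r, d, s, h1, h2, h3, h4, h5⟩ := exists_cancellation u u
  have h6 : r * d⁻¹ = d * s := h1.symm.trans h2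
  obtain ⟨e, rfl, h7, h8⟩ := exists_eq_mul_of_mul_eq_mul h6
    (by rw [← h1, norm_inv_eq, h3]) (by rw [← h2, h4]) (by omega)
  -- Now `u = r * e * s = r * e⁻¹ * r⁻¹`, so that `e` is its own inverse.
  have h9 : e⁻¹ * r⁻¹ = e * s := by rw [← h7]; group
  have h10 : (e⁻¹ * r⁻¹).norm = e.norm + r.norm := by
    rw [← mul_inv_rev, norm_inv_eq, h8, add_comm]
  have h11 : (e * s).norm = e.norm + s.norm := by
    rw [← h9, h10]; omega
  obtain ⟨h12, -⟩ := eq_of_mul_eq_mul_of_norm_eq h9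
    (by rw [h10, norm_inv_eq, norm_inv_eq]) h11 (by rw [norm_inv_eq])
  have h13 : e ^ 2 = 1 := by rw [pow_two]; nth_rw 1 [← h12]; simp
  obtain rfl : e = 1 := by simpa using h13
  exact hu (by rw [h1]; simp)

/-- A word with half of it cancelled by `u` on the left and half by `u⁻¹` on the right is trivial,
its two halves being inverse to each other. -/
theorem eq_one_of_norm_mul_eq {u v : FreeGroup α} (h : (u * v).norm = u.norm)
    (h' : (v * u⁻¹).norm = u.norm) : v = 1 := by
  obtain ⟨r, d, s, h1, h2, h3, h4, h5⟩ := exists_cancellation u v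
  obtain ⟨s', e, t, h6, h7, h8, h9, h10⟩ := exists_cancellation v u⁻¹
  rw [norm_inv_eq] at h9
  have h11 : d * r⁻¹ = e * t := by rw [← h7, h1]; group
  obtain ⟨rfl, -⟩ := eq_of_mul_eq_mul_of_norm_eq h11
    (by rw [norm_inv_eq, show d * r⁻¹ = u⁻¹ by rw [h1]; group, norm_inv_eq, h3, add_comm])
    (by rw [← h7, norm_inv_eq, h9]) (by omega)
  obtain ⟨rfl, -⟩ := eq_of_mul_eq_mul_of_norm_eq (h2.symm.trans h6)
    (by rw [← h2, h4]) (by rw [← h6, norm_inv_eq, h8]) (by omega)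
  rw [h6, mul_inv_cancel]

/-- The case in which both halves of `v` are cancelled by the same word `u`, from either side: then
`u * v = s⁻¹ * t * s` with `s` the right half of `v`, so that conjugation by `s` shortens the pair
`(u * v, v)`. -/
theorem exists_conj_norm_lt {u v : FreeGroup α} (hv : v ≠ 1) (hvu : v.norm ≤ u.norm)
    (h : (u * v).norm = u.norm) (h' : (v * u).norm = u.norm) :
    ∃ s : FreeGroup α,
      (s * (u * v) * s⁻¹).norm + (s * v * s⁻¹).norm < u.norm + v.norm := by
  obtain ⟨r, d, s, h1, h2, h3, h4, h5⟩ := exists_cancellation u v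
  obtain ⟨p, e, t, h6, h7, h8, h9, h10⟩ := exists_cancellation v u
  obtain ⟨rfl, rfl⟩ := eq_of_mul_eq_mul_of_norm_eq (h2.symm.trans h6)
    (by rw [← h2, h4]) (by rw [← h6, norm_inv_eq, h8]) (by omega)
  rw [norm_inv_eq] at *
  obtain ⟨m, rfl, h11, h12⟩ := exists_eq_mul_of_mul_eq_mul (h7.symm.trans h1)
    (by rw [← h7, h9]) (by rw [← h1, norm_inv_eq, h3]) (by omega)
  have hpos : v.norm ≠ 0 := by rwa [Ne, norm_eq_zero]
  refine ⟨e⁻¹, ?_⟩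
  have e1 : e⁻¹ * (u * v) * e⁻¹⁻¹ = m := by rw [h1, h2]; group
  have e2 : e⁻¹ * v * e⁻¹⁻¹ = e⁻¹ * d := by rw [h2]; group
  have e3 := norm_mul_le e⁻¹ d
  rw [norm_inv_eq] at e3
  rw [e1, e2]
  omega

end FreeGroup

namespace F2

/-! ### Palindromes and reversing elements -/

theorem Psi_mul (a b : F2) : Psi (a * b) = Psi b * Psi a := by simp [Psi]

theorem Psi_inv (a : F2) : Psi a⁻¹ = (Psi a)⁻¹ := by simp [Psi]

theorem Psi_one : Psi 1 = 1 := by simp [Psi]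

theorem Psi_x : Psi x = x := by
  simp [Psi, alphaX, alphaY, x]

theorem Psi_y : Psi y = y := by
  simp [Psi, alphaX, alphaY, y]

theorem Psi_Psi (a : F2) : Psi (Psi a) = a := by
  have h : ((alphaX.trans alphaY).trans (alphaX.trans alphaY)).toMonoidHom = MonoidHom.id F2 := by
    ext i
    fin_cases i <;> simp [alphaX, alphaY, x, y]
  simpa [Psi] using DFunLike.congr_fun h a

/-- Some palindrome `g` conjugates the reversals of `a` and of `b` to `a` and `b`, simultaneously.
For a basis `(a, b)`, this says that inverting both `a` and `b` is, up to an inner automorphism, the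
same automorphism as inverting both `x` and `y`. -/
def CommonReversal (a b : F2) : Prop :=
  ∃ g : F2, IsPalindrome g ∧ Psi a = g⁻¹ * a * g ∧ Psi b = g⁻¹ * b * g

theorem CommonReversal.symm {a b : F2} : CommonReversal a b → CommonReversal b a
  | ⟨g, hg, ha, hb⟩ => ⟨g, hg, hb, ha⟩

theorem CommonReversal.inv_left {a b : F2} : CommonReversal a b → CommonReversal a⁻¹ b
  | ⟨g, hg, ha, hb⟩ => ⟨g, hg, by rw [Psi_inv, ha]; group, hb⟩

theorem CommonReversal.mul_left {a b : F2} : CommonReversal a b → CommonReversal (a * b) b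
  | ⟨g, hg, ha, hb⟩ => by
    refine ⟨b⁻¹ * g, ?_, by rw [Psi_mul, ha, hb]; group, by rw [hb]; group⟩
    rw [IsPalindrome, Psi_mul, Psi_inv, hb, hg]
    group

theorem CommonReversal.conj {a b : F2} (c : F2) :
    CommonReversal a b → CommonReversal (c * a * c⁻¹) (c * b * c⁻¹)
  | ⟨g, hg, ha, hb⟩ => by
    refine ⟨c * g * Psi c, ?_, ?_, ?_⟩
    · rw [IsPalindrome, Psi_mul, Psi_mul, Psi_Psi, hg, mul_assoc]
    · rw [Psi_mul, Psi_mul, Psi_inv, ha]; group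
    · rw [Psi_mul, Psi_mul, Psi_inv, hb]; group

theorem CommonReversal.exists_mul_eq {a b : F2} :
    CommonReversal a b → ∃ u v : F2, IsPalindrome u ∧ IsPalindrome v ∧ a = u * v
  | ⟨g, hg, ha, _⟩ => by
    refine ⟨a * g, g⁻¹, ?_, ?_, by group⟩
    · rw [IsPalindrome, Psi_mul, ha, hg]; group
    · rw [IsPalindrome, Psi_inv, hg]

/-! ### Generating pairs -/

/-- `a` and `b` generate `F2`. -/
def Generates (a b : F2) : Prop := ∀ H : Subgroup F2, a ∈ H → b ∈ H → H = ⊤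

theorem generates_x_y : Generates x y := by
  intro H hx hy
  rw [eq_top_iff, ← FreeGroup.closure_range_of (Fin 2), Subgroup.closure_le]
  rintro _ ⟨i, rfl⟩
  fin_cases i
  exacts [hx, hy]

theorem Generates.map {a b : F2} (h : Generates a b) (θ : MulAut F2) :
    Generates (θ a) (θ b) := by
  intro H ha hb
  have := h (H.comap θ.toMonoidHom) ha hb
  rw [eq_top_iff]
  intro w _
  have hw : θ.symm w ∈ H.comap θ.toMonoidHom := this ▸ Subgroup.mem_top _
  simpa using hw

theorem Generates.symm {a b : F2} (h : Generates a b) : Generates b a :=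
  fun H ha hb => h H hb ha

theorem Generates.inv_left {a b : F2} (h : Generates a b) : Generates a⁻¹ b :=
  fun H ha hb => h H (inv_mem_iff.1 ha) hb

theorem Generates.mul_left {a b : F2} (h : Generates a b) : Generates (a * b) b :=
  fun H ha hb => h H ((H.mul_mem_cancel_right hb).1 ha) hb

theorem Generates.left_ne_one {a b : F2} (h : Generates a b) : a ≠ 1 := by
  rintro rfl
  have htop := h (Subgroup.zpowers b) (one_mem _) (Subgroup.mem_zpowers b)
  obtain ⟨m, hm⟩ := Subgroup.mem_zpowers_iff.1 (htop ▸ Subgroup.mem_top x)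
  obtain ⟨n, hn⟩ := Subgroup.mem_zpowers_iff.1 (htop ▸ Subgroup.mem_top y)
  have hxy : x * y = y * x := by rw [← hm, ← hn, ← zpow_add, ← zpow_add, add_comm]
  revert hxy
  decide

/-! ### Words in a pair of elements -/

/-- The value of the signed letter `p` under the substitution of `a` for `x` and `b` for `y`. -/
def letter (a b : F2) (p : Fin 2 × Bool) : F2 := FreeGroup.lift ![a, b] (FreeGroup.mk [p])

theorem letter_eq_or_eq_inv (a b : F2) {p q : Fin 2 × Bool} (hpq : p.1 = q.1) :
    letter a b p = letter a b q ∨ letter a b p = (letter a b q)⁻¹ := by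
  obtain ⟨i, s⟩ := p
  obtain ⟨j, t⟩ := q
  obtain rfl : i = j := hpq
  cases s <;> cases t <;> simp [letter]

theorem lift_mk_cons (a b : F2) (p : Fin 2 × Bool) (L : List (Fin 2 × Bool)) :
    FreeGroup.lift ![a, b] (FreeGroup.mk (p :: L)) =
      letter a b p * FreeGroup.lift ![a, b] (FreeGroup.mk L) := by
  rw [letter, ← map_mul, FreeGroup.mul_mk, List.singleton_append]

/-! ### Shortest pairs without a common reversal -/

/-- A generating pair without a common reversal, of least total length among such pairs. -/
def IsMinimalCounterexample (a b : F2) : Prop :=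
  (Generates a b ∧ ¬ CommonReversal a b) ∧
    ∀ c d : F2, Generates c d → ¬ CommonReversal c d → a.norm + b.norm ≤ c.norm + d.norm

namespace IsMinimalCounterexample

variable {a b : F2}

theorem symm (h : IsMinimalCounterexample a b) : IsMinimalCounterexample b a :=
  ⟨⟨h.1.1.symm, fun hr => h.1.2 hr.symm⟩, by simpa only [add_comm] using h.2⟩

theorem inv_left (h : IsMinimalCounterexample a b) : IsMinimalCounterexample a⁻¹ b :=
  ⟨⟨h.1.1.inv_left, fun hr => h.1.2 (by simpa using hr.inv_left)⟩,
    by simpa only [FreeGroup.norm_inv_eq] using h.2⟩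

theorem inv_right (h : IsMinimalCounterexample a b) : IsMinimalCounterexample a b⁻¹ :=
  h.symm.inv_left.symm

/-- The passage from `(a, b)` to `(a * b, b)` can be undone, so it preserves the absence of a common
reversal. -/
theorem not_commonReversal_mul (h : IsMinimalCounterexample a b) : ¬ CommonReversal (a * b) b := by
  intro hr
  have := hr.symm.inv_left.symm.mul_left.symm.inv_left.symm
  simp only [mul_inv_cancel_right, inv_inv] at this
  exact h.1.2 this

theorem norm_left_le (h : IsMinimalCounterexample a b) : a.norm ≤ (a * b).norm := by
  have := h.2 _ _ h.1.1.mul_left h.not_commonReversal_mul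
  omega

theorem norm_right_le (h : IsMinimalCounterexample a b) : b.norm ≤ (a * b).norm := by
  have := h.symm.inv_left.inv_right.norm_left_le
  rwa [← mul_inv_rev, FreeGroup.norm_inv_eq, FreeGroup.norm_inv_eq] at this

theorem norm_le_conj (h : IsMinimalCounterexample a b) (c : F2) :
    a.norm + b.norm ≤ (c * a * c⁻¹).norm + (c * b * c⁻¹).norm := by
  refine h.2 _ _ (h.1.1.map (MulAut.conj c)) fun hr => h.1.2 ?_
  have := hr.conj c⁻¹
  rwa [show c⁻¹ * (c * a * c⁻¹) * c⁻¹⁻¹ = a by group,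
    show c⁻¹ * (c * b * c⁻¹) * c⁻¹⁻¹ = b by group] at this

/-- Half of `b` cannot cancel in `a * b` while the other half cancels in `b * a`: otherwise
`(a * b, b)` would also be minimal, and could be shortened by conjugation. -/
theorem norm_ne_or_norm_ne (h : IsMinimalCounterexample a b) :
    (a * b).norm ≠ a.norm ∨ (b * a).norm ≠ a.norm := by
  by_contra! hc
  obtain ⟨s, hs⟩ := FreeGroup.exists_conj_norm_lt h.1.1.symm.left_ne_one
    (hc.1 ▸ h.norm_right_le) hc.1 hc.2
  have h' : IsMinimalCounterexample (a * b) b :=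
    ⟨⟨h.1.1.mul_left, h.not_commonReversal_mul⟩, by rw [hc.1]; exact h.2⟩
  have := h'.norm_le_conj s
  omega

/-! ### Reduced words in a shortest pair -/

/-- Distinct generators are sent to the members of a shortest pair, up to order and inversion. -/
theorem letter_of_ne (h : IsMinimalCounterexample a b) {p q : Fin 2 × Bool} (hpq : p.1 ≠ q.1) :
    IsMinimalCounterexample (letter a b p) (letter a b q) := by
  obtain ⟨i, s⟩ := p
  obtain ⟨j, t⟩ := q
  fin_cases i <;> fin_cases j <;> cases s <;> cases t <;>
    simp_all [letter, h.inv_left, h.inv_right, h.symm, h.inv_left.inv_right, h.symm.inv_left,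
      h.symm.inv_right, h.symm.inv_left.inv_right]

theorem letter_ne_one (h : IsMinimalCounterexample a b) (p : Fin 2 × Bool) : letter a b p ≠ 1 :=
  (h.letter_of_ne (q := (p.1 + 1, true)) (by simp)).1.1.left_ne_one

theorem norm_letter_le (h : IsMinimalCounterexample a b) {p q : Fin 2 × Bool}
    (hpq : p.1 = q.1 → p.2 = q.2) :
    (letter a b p).norm ≤ (letter a b p * letter a b q).norm ∧
      (letter a b q).norm ≤ (letter a b p * letter a b q).norm := by
  by_cases hc : p.1 = q.1
  · obtain rfl : p = q := Prod.ext hc (hpq hc)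
    have := (FreeGroup.norm_lt_norm_mul_self (h.letter_ne_one p)).le
    exact ⟨this, this⟩
  · exact ⟨(h.letter_of_ne hc).norm_left_le, (h.letter_of_ne hc).norm_right_le⟩

/-- In a product of three letters, the middle one does not cancel completely. -/
theorem norm_add_norm_lt (h : IsMinimalCounterexample a b) {p q r : Fin 2 × Bool}
    (hpq : p.1 = q.1 → p.2 = q.2) (hqr : q.1 = r.1 → q.2 = r.2) :
    (letter a b p).norm + (letter a b r).norm <
      (letter a b p * letter a b q).norm + (letter a b q * letter a b r).norm := by
  have h1 := (h.norm_letter_le hpq).1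
  have h2 := (h.norm_letter_le hqr).2
  by_contra! hle
  have h3 : (letter a b p * letter a b q).norm = (letter a b p).norm := by omega
  have h4 : (letter a b q * letter a b r).norm = (letter a b r).norm := by omega
  have hpq' : p.1 ≠ q.1 := by
    intro hc
    obtain rfl : p = q := Prod.ext hc (hpq hc)
    exact (FreeGroup.norm_lt_norm_mul_self (h.letter_ne_one _)).ne' h3
  have hqr' : q.1 ≠ r.1 := by
    intro hc
    obtain rfl : q = r := Prod.ext hc (hqr hc)
    exact (FreeGroup.norm_lt_norm_mul_self (h.letter_ne_one _)).ne' h4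
  -- There are only two generators, so the outer letters agree up to inversion.
  obtain hr | hr := letter_eq_or_eq_inv a b (show r.1 = p.1 by omega) <;> rw [hr] at h4
  · exact (h.letter_of_ne hpq').norm_ne_or_norm_ne.elim (· h3) (· h4)
  · rw [FreeGroup.norm_inv_eq] at h4
    exact h.letter_ne_one q (FreeGroup.eq_one_of_norm_mul_eq h3 h4)

/-- The cancellation at the left end of a reduced word in `a` and `b` only involves the first two
letters. -/
theorem norm_lift_mk_cons_cons (h : IsMinimalCounterexample a b) {p q : Fin 2 × Bool}
    {L : List (Fin 2 × Bool)} (hL : FreeGroup.IsReduced (p :: q :: L)) :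
    (FreeGroup.lift ![a, b] (FreeGroup.mk (p :: q :: L))).norm + (letter a b q).norm =
      (letter a b p * letter a b q).norm +
        (FreeGroup.lift ![a, b] (FreeGroup.mk (q :: L))).norm := by
  induction L generalizing p q with
  | nil =>
    rw [lift_mk_cons a b p]
    rfl
  | cons r L ih =>
    rw [FreeGroup.isReduced_cons_cons] at hL
    obtain ⟨hpq, hL⟩ := hL
    have h1 := ih hL
    have h2 := h.norm_add_norm_lt hpq (FreeGroup.isReduced_cons_cons.1 hL).1
    rw [lift_mk_cons a b p, lift_mk_cons a b q, ← mul_assoc]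
    rw [lift_mk_cons a b q] at h1
    exact FreeGroup.norm_mul_mul_add_norm (by omega)

theorem norm_letter_le_norm_lift (h : IsMinimalCounterexample a b) {p : Fin 2 × Bool}
    {L : List (Fin 2 × Bool)} (hL : FreeGroup.IsReduced (p :: L)) :
    (letter a b p).norm ≤ (FreeGroup.lift ![a, b] (FreeGroup.mk (p :: L))).norm := by
  induction L generalizing p with
  | nil => rfl
  | cons q L ih =>
    have h1 := h.norm_lift_mk_cons_cons hL
    rw [FreeGroup.isReduced_cons_cons] at hL
    have h2 := ih hL.2
    have h3 := (h.norm_letter_le hL.1).1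
    omega

/-- An element of length one is a reduced word of length one in any shortest pair. -/
theorem exists_letter_eq (h : IsMinimalCounterexample a b) {w : F2} (hw : w.norm = 1) :
    ∃ p, letter a b p = w := by
  obtain ⟨v, rfl⟩ : ∃ v, FreeGroup.lift ![a, b] v = w := by
    have := h.1.1 (FreeGroup.lift ![a, b]).range ⟨FreeGroup.of 0, by simp⟩
      ⟨FreeGroup.of 1, by simp⟩
    exact MonoidHom.range_eq_top.1 this w
  have hv : FreeGroup.IsReduced v.toWord := FreeGroup.isReduced_toWord
  rw [← FreeGroup.mk_toWord (x := v)] at hw ⊢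
  generalize v.toWord = L at hw hv ⊢
  match L, hv, hw with
  | [], _, hw => simp at hw
  | [p], _, _ => exact ⟨p, rfl⟩
  | p :: q :: L, hL, hw =>
    have h1 := h.norm_lift_mk_cons_cons hL
    rw [FreeGroup.isReduced_cons_cons] at hL
    have h2 := h.norm_letter_le_norm_lift hL.2
    have h3 := h.norm_letter_le hL.1
    have h4 : (letter a b p).norm ≠ 0 := by simpa using h.letter_ne_one p
    have h5 : (letter a b q).norm ≠ 0 := by simpa using h.letter_ne_one q
    -- Two words of length one would have a product of length one, contrary to parity.
    obtain ⟨r, d, s, -, -, h6, h7, h8⟩ :=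
      FreeGroup.exists_cancellation (letter a b p) (letter a b q)
    omega

end IsMinimalCounterexample

/-- A minimal counterexample would consist of `x` and `y`, up to order and inversion, and these have
the common reversal `1`. -/
theorem not_isMinimalCounterexample (a b : F2) : ¬ IsMinimalCounterexample a b := by
  intro h
  obtain ⟨p, hp⟩ := h.exists_letter_eq (w := x) (FreeGroup.norm_of 0)
  obtain ⟨q, hq⟩ := h.exists_letter_eq (w := y) (FreeGroup.norm_of 1)
  by_cases hpq : p.1 = q.1
  · have hxy := letter_eq_or_eq_inv a b hpq
    rw [hp, hq] at hxy
    revert hxy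
    decide
  · have h' := h.letter_of_ne hpq
    rw [hp, hq] at h'
    exact h'.1.2 ⟨1, Psi_one, by simpa using Psi_x, by simpa using Psi_y⟩

theorem Generates.commonReversal {a b : F2} (h : Generates a b) : CommonReversal a b := by
  by_contra hr
  obtain ⟨⟨c, d⟩, hcd, hmin⟩ := WellFounded.has_min
    (InvImage.wf (fun p : F2 × F2 => p.1.norm + p.2.norm) wellFounded_lt)
    {p | Generates p.1 p.2 ∧ ¬ CommonReversal p.1 p.2} ⟨(a, b), h, hr⟩
  exact not_isMinimalCounterexample c d
    ⟨hcd, fun c' d' hg hr' => not_lt.1 (hmin (c', d') ⟨hg, hr'⟩)⟩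

end F2

theorem mainTheorem4 (p : F2) (hp : F2.IsPrimitive p) :
    F2.IsPalindrome p ∨
      ∃ u v : F2, F2.IsPalindrome u ∧ F2.IsPalindrome v ∧ p = u * v := by
  obtain ⟨θ, rfl⟩ := hp
  exact .inr (F2.generates_x_y.map θ).commonReversal.exists_mul_eq
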